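/- Let $r,n\ge 1$ be integers and let $G_{r,n}=(\mathbb Z/r\mathbb Z)\wr\mathfrak S_n$ be the set of pairs $\pi=(\sigma,z)$ with $\sigma\in\mathfrak S_n$ and $z=(z_1,\dots,z_n)\in(\mathbb Z/r\mathbb Z)^n$, with product $(\sigma,z)(\rho,w)=(\sigma\rho,\,(w_i+z_{\rho(i)})_i)$. Colors $z_i$ are represented in $\{0,\dots,r-1\}$. Write $\pi$ as the word $\pi(1)\cdots\pi(n)$ of colored letters $\pi(i)=\sigma_i^{[z_i]}$, where $a=a^{[0]}$, and put $\pi(i^{[t]})=\sigma_i^{[z_i+t]}$. Let $f=(f_1,\dots,f_n)$ be integers with $1\le f_1\le\cdots\le f_n\le n$, and let $$G_{r,n,f}=\{(\sigma,z)\in G_{r,n}:\ \sigma_i\le f_i\text{ for all }i\}.$$ Length. $\ell(\pi)$ is the least number of factors in an expression of $\pi$ as a product of the generators $s_0,\dots,s_{n-1}$, where right multiplication by $s_0$ adds $1$ to the color of the first letter of the word and right multiplication by $s_i$ ($1\le i\le n-1$) swaps its $i$-th and $(i+1)$-st letters. Sorting index. For $i<j$ and a color $t$ let $(i^{[t]}\,j)$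 be the element such that right multiplication by it replaces $\pi(j)$ by $\sigma_i^{[z_i+t]}$ and $\pi(i)$ by $\sigma_j^{[z_j-t]}$; right multiplication by $(j^{[t]}\,j)$ replaces $\pi(j)$ by $\sigma_j^{[z_j+t]}$. Put $\pi^{(n)}=\pi$ and, for $j=n,n-1,\dots,1$, let $(i_j,t_j)$ with $1\le i_j\le j$ and $0\le t_j<r$ be determined by $\pi^{(j)}(i_j^{[t_j]})=j$, and put $\pi^{(j-1)}=\pi^{(j)}\cdot(i_j^{[t_j]}\,j)$; thus $\pi^{(0)}$ is the identity. Then $$\mathrm{sor}(\pi)=\sum_{j=1}^n\Big(j-i_j+\chi(t_j>0)\,\big(2(i_j-1)+t_j\big)\Big),$$ where $\chi(\cdot)$ is $1$ if the condition holds and $0$ otherwise. Set-valued statistics. Let $$\begin{aligned}\mathrm{Rmil}(\pi)&=\{\sigma_i^{[z_i]}:\sigma_i<\sigma_j\ \forall j>i\}, & \mathrm{Lmil}(\pi)&=\{\sigma_i^{[z_i]}:\sigma_i<\sigma_j\ \forall j<i\},\\ \mathrm{Lmal}(\pi)&=\{\sigma_i^{[z_i]}:\sigma_i>\sigma_j\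 \forall j<i\}, & \mathrm{Lmap}(\pi)&=\{i^{[z_i]}:\sigma_i>\sigma_j\ \forall j<i\}.\end{aligned}$$ Let $\mathrm{Cyc}(\pi)$ be the set of all $\alpha^{[c]}$ where $\alpha$ is the smallest element of a cycle of $\sigma$ and $c$ is the sum modulo $r$ of the $z_i$ over the elements $i$ of that cycle. Let $\mathrm{Lmic}(\pi)$ be the set of left-to-right minimum letters (comparing only base values, as in $\mathrm{Lmil}$) of the word $\pi(1)\,\pi^2(1)\,\pi^3(1)\cdots$. For each of these statistics $\mathrm{Stat}$ and each $t$ let $\mathrm{Stat}^t(\pi)=\{a:a^{[t]}\in\mathrm{Stat}(\pi)\}$. Theorem. For all $r$, $n$, $f$ as above, the two tuples of statistics $$\big(\ell,\ \mathrm{Rmil}^0,\mathrm{Rmil}^1,\dots,\mathrm{Rmil}^{r-1},\ \mathrm{Lmil}^0,\mathrm{Lmil}^1,\dots,\mathrm{Lmil}^{r-1},\ \mathrm{Lmal}^0,\mathrm{Lmal}^1,\dots,\mathrm{Lmal}^{r-1},\ \mathrm{Lmap}^0,\mathrm{Lmap}^1,\dots,\mathrm{Lmap}^{r-1}\big)$$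 and $$\big(\mathrm{sor},\ \mathrm{Cyc}^0,\mathrm{Cyc}^{r-1},\dots,\mathrm{Cyc}^1,\ \mathrm{Lmic}^0,\mathrm{Lmic}^{r-1},\dots,\mathrm{Lmic}^1,\ \mathrm{Lmal}^0,\mathrm{Lmal}^{r-1},\dots,\mathrm{Lmal}^1,\ \mathrm{Lmap}^0,\mathrm{Lmap}^{r-1},\dots,\mathrm{Lmap}^1\big)$$ have the same joint distribution over $G_{r,n,f}$; that is, every tuple of values is attained by the same number of elements of $G_{r,n,f}$ under the first tuple as under the second. -/

import Mathlib

/-- A colored permutation `(σ, z)` of `n` letters with `r` colors, an element of the wreath product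
of `ℤ/rℤ` with the symmetric group.  The letter `k ∈ {1, …, n}` is represented by the element of
`Fin n` with value `k - 1`.  In window notation it is the word
`σ 1 ^[z 1] σ 2 ^[z 2] ⋯ σ n ^[z n]`. -/
@[ext]
structure ColPerm (r n : ℕ) where
  perm : Equiv.Perm (Fin n)
  color : Fin n → ZMod r

namespace ColPerm

variable {r n : ℕ}

instance : One (ColPerm r n) := ⟨⟨1, 0⟩⟩

/-- `(σ, z) (ρ, w) = (σ ρ, w + ρ(z))`, where `ρ(z) = (z_{ρ(1)}, …, z_{ρ(n)})`. -/
instance : Mul (ColPerm r n) :=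
  ⟨fun π τ => ⟨π.perm * τ.perm, fun i => τ.color i + π.color (τ.perm i)⟩⟩

instance : Inv (ColPerm r n) :=
  ⟨fun π => ⟨π.perm⁻¹, fun i => -π.color (π.perm⁻¹ i)⟩⟩

instance : Group (ColPerm r n) :=
  Group.ofLeftAxioms
    (fun a b c => by
      ext i
      · rfl
      · change c.color i + (b.color (c.perm i) + a.color (b.perm (c.perm i))) =
          c.color i + b.color (c.perm i) + a.color (b.perm (c.perm i))
        rw [add_assoc])
    (fun a => by
      ext i
      · rfl
      · exact add_zero _)
    (fun a => by
      ext i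
      · change ((a.perm⁻¹ * a.perm) i : Fin n).val = _
        rw [inv_mul_cancel]
        rfl
      · change a.color i + -a.color (a.perm⁻¹ (a.perm i)) = 0
        simp)

instance [NeZero r] : Finite (ColPerm r n) :=
  Finite.of_injective (fun π : ColPerm r n => (π.perm, π.color)) fun a b h => by
    simp only [Prod.mk.injEq] at h
    exact ColPerm.ext h.1 h.2

/-- The window notation of `π`: its `i`-th entry is the colored letter `π(i) = σ i ^[z i]`, a letter
`a` with color `c` being the pair `(a, c)`. -/
def window (π : ColPerm r n) (i : Fin n) : Fin n × ZMod r := (π.perm i, π.color i)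

/-! ### Length -/

/-- The generators: `s_0` adds one bar to the first letter, and `s_i`, for `1 ≤ i ≤ n - 1`, swaps the
`i`-th and the `(i+1)`-th letter of the window. -/
def generators (r n : ℕ) [NeZero n] : Set (ColPerm r n) :=
  {⟨1, Pi.single 0 1⟩} ∪
    {s | ∃ i j : Fin n, (i : ℕ) + 1 = j ∧ s = ⟨Equiv.swap i j, 0⟩}

/-- The length: the least number of generators whose product is `π`. -/
noncomputable def length [NeZero n] (π : ColPerm r n) : ℕ :=
  sInf {k | ∃ L : List (ColPerm r n), (∀ s ∈ L, s ∈ generators r n) ∧ L.prod = π ∧ L.length = k}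

/-! ### Sorting index -/

/-- The element `(i^[t] j)`.  For `i ≠ j`, right multiplication by it replaces the `j`-th letter
`π(j)` by `π(i)` with `t` added to its color, and `π(i)` by `π(j)` with `t` subtracted from its color.
Right multiplication by `(i^[t] i)` adds `t` to the color of `π(i)`. -/
def transp (i : Fin n) (t : ZMod r) (j : Fin n) : ColPerm r n :=
  ⟨Equiv.swap i j, fun k => if k = j then t else if k = i then -t else 0⟩

/-- The number of steps that `(i^[t] j)` costs, for `i ≤ j`: `j - i`, and `2 (i - 1) + t` more if the
color `t ∈ {0, …, r - 1}` is positive (`i - 1` is the value of `i : Fin n`). -/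
def sortCost (i : Fin n) (t : ZMod r) (j : Fin n) : ℕ :=
  ((j : ℕ) - i) + if t = 0 then 0 else 2 * (i : ℕ) + t.val

/-- The total cost of moving the letters in the given list back to their places, one after the other.
The letter `j` is found at the column `i` and row `t` with `π(i^[t]) = j`, which means that
`σ i = j` and `z i + t = 0`; then `π` is replaced by `π · (i^[t] j)`, which maps `j` to `j`. -/
def sortFrom : List (Fin n) → ColPerm r n → ℕ
  | [], _ => 0
  | j :: js, π =>
    let i := π.perm⁻¹ j
    let t := -π.color i
    sortCost i t j + sortFrom js (π * transp i t j)

/-- The sorting index: the total cost of moving `n, n - 1, …, 1`, in this order, back in place. -/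
def sor (π : ColPerm r n) : ℕ := sortFrom (List.finRange n).reverse π

/-! ### Set-valued statistics -/

/-- The refinement `S^t = {a : a^[t] ∈ S}` of a set `S` of colored letters (or places). -/
def colorPart (S : Set (Fin n × ZMod r)) (t : ZMod r) : Set (Fin n) := {a | (a, t) ∈ S}

/-- The left-to-right minimum letters (with respect to base values) of a word of colored letters. -/
def wordLmil {ι : Type*} [LT ι] (w : ι → Fin n × ZMod r) : Set (Fin n × ZMod r) :=
  {x | ∃ i, x = w i ∧ ∀ j, j < i → (w i).1 < (w j).1}

/-- Right-to-left minimum letters. -/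
def Rmil (π : ColPerm r n) : Set (Fin n × ZMod r) :=
  {x | ∃ i, x = π.window i ∧ ∀ j, i < j → π.perm i < π.perm j}

/-- Left-to-right minimum letters. -/
def Lmil (π : ColPerm r n) : Set (Fin n × ZMod r) := wordLmil π.window

/-- Left-to-right maximum letters. -/
def Lmal (π : ColPerm r n) : Set (Fin n × ZMod r) :=
  {x | ∃ i, x = π.window i ∧ ∀ j, j < i → π.perm j < π.perm i}

/-- Left-to-right maximum places. -/
def Lmap (π : ColPerm r n) : Set (Fin n × ZMod r) :=
  {x | ∃ i, x = (i, π.color i) ∧ ∀ j, j < i → π.perm j < π.perm i}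

/-- Left-to-right minimum letters in the first cycle: `Lmil` of the word `π(1) π²(1) π³(1) ⋯`. -/
def Lmic [NeZero n] (π : ColPerm r n) : Set (Fin n × ZMod r) :=
  wordLmil fun k : ℕ => (π ^ (k + 1)).window 0

open Classical in
/-- The colored cycle set: for every cycle of `σ`, its smallest element, colored by the sum (mod `r`)
of the colors of the letters in the cycle. -/
noncomputable def Cyc (π : ColPerm r n) : Set (Fin n × ZMod r) :=
  {x | (∀ i, π.perm.SameCycle x.1 i → x.1 ≤ i) ∧
    x.2 = ∑ i ∈ Finset.univ.filter (fun i => π.perm.SameCycle x.1 i), π.color i}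

/-- The colored permutations restricted to the Ferrers shape `f`. -/
def restricted (r : ℕ) (f : Fin n → Fin n) : Set (ColPerm r n) :=
  {π | ∀ i, π.perm i ≤ f i}

end ColPerm

namespace ColPerm

variable {r n : ℕ}

/-! Elements on `n + 1` letters are built from elements on `n` letters in two ways, both with a
parameter `(p, c)`. `insertLetter` puts the largest letter with color `c` at place `p` of the
window; `insertCycle` undoes a sorting step, which splices the largest letter into the cycle
structure after `p` and gives `p` the color `-c`. Both are bijections from `ColPerm r n × Fin (n +
1) × ZMod r`.

Under the same `(p, c)` the statistics of the two sides change alike, up to the sign of the color.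
Length and sorting index both grow by `sortCost p c (Fin.last n)`; `Rmil` and `Cyc` gain the new
letter iff `p` is last; `Lmil` and `Lmic` gain it iff `p = 0`; the left-to-right maxima become those
before `p`, together with `p`. Induction on `n` gives a bijection satisfying `Corresponds`. It
respects the Ferrers restriction, since for monotone `f` this is a condition on the left-to-right
maxima alone (`mem_restricted_iff`).

The length is not recursive by definition, so it is first identified with the explicit `lengthSum`:
this vanishes at `1`, grows by at most one under a generator, and can be lowered by one at every
element other than `1`. -/

@[simp] theorem mul_perm (π τ : ColPerm r n) : (π * τ).perm = π.perm * τ.perm := rfl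

@[simp] theorem mul_color (π τ : ColPerm r n) (i : Fin n) :
    (π * τ).color i = τ.color i + π.color (τ.perm i) := rfl

@[simp] theorem one_perm : (1 : ColPerm r n).perm = 1 := rfl

@[simp] theorem one_color (i : Fin n) : (1 : ColPerm r n).color i = 0 := rfl

theorem inv_perm (π : ColPerm r n) : π⁻¹.perm = π.perm⁻¹ := rfl

theorem inv_color (π : ColPerm r n) (i : Fin n) : π⁻¹.color i = -π.color (π.perm⁻¹ i) := rfl

theorem ext_apply {π τ : ColPerm r n} (h : ∀ i, π.perm i = τ.perm i)
    (h' : ∀ i, π.color i = τ.color i) : π = τ :=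
  ColPerm.ext (Equiv.ext h) (funext h')

/-! ### Inserting the largest letter into the window -/

/-- Insert the largest letter, with color `c`, at the place `p` of the window of `π`. -/
def insertLetter (π : ColPerm r n) (p : Fin (n + 1)) (c : ZMod r) : ColPerm r (n + 1) :=
  ⟨((finSuccEquiv' p).trans (Equiv.optionCongr π.perm)).trans (finSuccEquiv' (Fin.last n)).symm,
    Fin.insertNth (α := fun _ => ZMod r) p c π.color⟩

section insertLetter

variable (π : ColPerm r n) (p : Fin (n + 1)) (c : ZMod r)

@[simp] theorem insertLetter_perm_same : (insertLetter π p c).perm p = Fin.last n := by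
  simp [insertLetter]

@[simp] theorem insertLetter_perm_succAbove (i : Fin n) :
    (insertLetter π p c).perm (p.succAbove i) = (π.perm i).castSucc := by
  simp [insertLetter]

@[simp] theorem insertLetter_color_same : (insertLetter π p c).color p = c := by
  simp [insertLetter]

@[simp] theorem insertLetter_color_succAbove (i : Fin n) :
    (insertLetter π p c).color (p.succAbove i) = π.color i := by
  simp [insertLetter]

end insertLetter

/-- Regard a colored permutation of `n` letters as one of `n + 1` letters fixing the last one. -/
def extend (π : ColPerm r n) : ColPerm r (n + 1) := insertLetter π (Fin.last n) 0

section extend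

variable (π : ColPerm r n)

@[simp] theorem extend_perm_last : (extend π).perm (Fin.last n) = Fin.last n :=
  insertLetter_perm_same _ _ _

@[simp] theorem extend_perm_castSucc (i : Fin n) :
    (extend π).perm i.castSucc = (π.perm i).castSucc := by
  rw [← Fin.succAbove_last_apply]; exact insertLetter_perm_succAbove _ _ _ _

@[simp] theorem extend_color_last : (extend π).color (Fin.last n) = 0 :=
  insertLetter_color_same _ _ _

@[simp] theorem extend_color_castSucc (i : Fin n) :
    (extend π).color i.castSucc = π.color i := by
  rw [← Fin.succAbove_last_apply]; exact insertLetter_color_succAbove _ _ _ _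

theorem extend_perm_inv_castSucc (i : Fin n) :
    (extend π).perm⁻¹ i.castSucc = (π.perm⁻¹ i).castSucc := by
  rw [Equiv.Perm.inv_eq_iff_eq]; simp

theorem extend_mul (τ : ColPerm r n) : extend (π * τ) = extend π * extend τ := by
  apply ext_apply <;> intro i <;> refine Fin.lastCases ?_ (fun i => ?_) i <;> simp

theorem extend_transp (i : Fin n) (t : ZMod r) (j : Fin n) :
    extend (transp i t j) = transp i.castSucc t j.castSucc := by
  apply ext_apply <;> intro k <;> refine Fin.lastCases ?_ (fun k => ?_) k
  · simp [transp, Equiv.swap_apply_of_ne_of_ne, Fin.ext_iff, ne_of_gt]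
  · simp [transp, Equiv.swap_apply_def, apply_ite Fin.castSucc]
  · simp [transp, Fin.ext_iff, ne_of_gt]
  · simp [transp]

end extend

theorem extend_injective : Function.Injective (extend : ColPerm r n → ColPerm r (n + 1)) := by
  intro π τ h
  apply ext_apply <;> intro i
  · have := congrArg (fun π => π.perm i.castSucc) h
    simpa using this
  · have := congrArg (fun π => π.color i.castSucc) h
    simpa using this

/-! ### Inserting the largest letter into the cycles -/

/-- Undo the sorting step that uses the element `(p^[c] n + 1)`. -/
def insertCycle (π : ColPerm r n) (p : Fin (n + 1)) (c : ZMod r) : ColPerm r (n + 1) :=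
  extend π * (transp p c (Fin.last n))⁻¹

section insertCycle

variable (π : ColPerm r n) (p : Fin (n + 1)) (c : ZMod r)

@[simp] theorem insertCycle_perm_same : (insertCycle π p c).perm p = Fin.last n := by
  simp [insertCycle, inv_perm, transp]

theorem insertCycle_perm_castSucc (i : Fin n) (h : i.castSucc ≠ p) :
    (insertCycle π p c).perm i.castSucc = (π.perm i).castSucc := by
  simp [insertCycle, inv_perm, transp, Equiv.swap_apply_of_ne_of_ne h (Fin.castSucc_ne_last i)]

theorem insertCycle_perm_last (p : Fin n) :
    (insertCycle π p.castSucc c).perm (Fin.last n) = (π.perm p).castSucc := by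
  simp [insertCycle, inv_perm, transp]

@[simp] theorem insertCycle_color_same : (insertCycle π p c).color p = -c := by
  simp [insertCycle, inv_perm, inv_color, transp]

theorem insertCycle_color_castSucc (i : Fin n) (h : i.castSucc ≠ p) :
    (insertCycle π p c).color i.castSucc = π.color i := by
  simp [insertCycle, inv_perm, inv_color, transp, h,
    Equiv.swap_apply_of_ne_of_ne h (Fin.castSucc_ne_last i)]

/-- In the cycle the arrow `p ↦ π p` becomes `p ↦ last ↦ π p`; the colors `-c` and `c + π.color p`
of the two new arrows add up to the old color. -/
theorem insertCycle_color_last (p : Fin n) :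
    (insertCycle π p.castSucc c).color (Fin.last n) = c + π.color p := by
  simp [insertCycle, inv_perm, inv_color, transp, (Fin.castSucc_ne_last p)]

end insertCycle

theorem insertLetter_injective :
    Function.Injective fun x : ColPerm r n × Fin (n + 1) × ZMod r =>
      insertLetter x.1 x.2.1 x.2.2 := by
  rintro ⟨π, p, c⟩ ⟨τ, q, d⟩ h
  dsimp only at h
  have hpq : p = q := by
    apply (insertLetter τ q d).perm.injective
    rw [insertLetter_perm_same, ← h, insertLetter_perm_same]
  subst hpq
  have hc : c = d := by
    rw [← insertLetter_color_same π p c, h, insertLetter_color_same]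
  subst hc
  have : π = τ := by
    apply ext_apply <;> intro i
    · simpa using congrArg (fun π => π.perm (p.succAbove i)) h
    · simpa using congrArg (fun π => π.color (p.succAbove i)) h
  rw [this]

theorem insertCycle_injective :
    Function.Injective fun x : ColPerm r n × Fin (n + 1) × ZMod r =>
      insertCycle x.1 x.2.1 x.2.2 := by
  rintro ⟨π, p, c⟩ ⟨τ, q, d⟩ h
  dsimp only at h
  have hpq : p = q := by
    apply (insertCycle τ q d).perm.injective
    rw [insertCycle_perm_same, ← h, insertCycle_perm_same]
  subst hpq
  have hc : c = d := by
    rw [← neg_inj, ← insertCycle_color_same π p c, h, insertCycle_color_same]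
  subst hc
  rw [extend_injective (mul_right_cancel h)]

/-- With this count, injectivity of the two insertions is enough for bijectivity, and no inverse has
to be constructed. -/
theorem natCard_succ [NeZero r] :
    Nat.card (ColPerm r n × Fin (n + 1) × ZMod r) = Nat.card (ColPerm r (n + 1)) := by
  have key (m : ℕ) : Nat.card (ColPerm r m) = m.factorial * r ^ m := by
    have e : ColPerm r m ≃ Equiv.Perm (Fin m) × (Fin m → ZMod r) :=
      ⟨fun π => (π.perm, π.color), fun x => ⟨x.1, x.2⟩, fun _ => rfl, fun _ => rfl⟩
    rw [Nat.card_congr e, Nat.card_prod]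
    simp [Fintype.card_perm]
  simp only [Nat.card_prod, key, Nat.card_fin, Nat.card_zmod, Nat.factorial_succ]
  ring

/-- `insertLetter` as an equivalence. -/
noncomputable def insertLetterEquiv [NeZero r] :
    ColPerm r n × Fin (n + 1) × ZMod r ≃ ColPerm r (n + 1) :=
  Equiv.ofBijective _
    (insertLetter_injective.bijective_of_nat_card_le natCard_succ.ge)

/-- `insertCycle` as an equivalence. -/
noncomputable def insertCycleEquiv [NeZero r] :
    ColPerm r n × Fin (n + 1) × ZMod r ≃ ColPerm r (n + 1) :=
  Equiv.ofBijective _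
    (insertCycle_injective.bijective_of_nat_card_le natCard_succ.ge)

/-! ### The sorting index -/

theorem sortFrom_map_castSucc (L : List (Fin n)) (π : ColPerm r n) :
    sortFrom (L.map Fin.castSucc) (extend π) = sortFrom L π := by
  induction L generalizing π with
  | nil => rfl
  | cons j L ih =>
    simp only [List.map_cons, sortFrom, extend_perm_inv_castSucc, extend_color_castSucc,
      ← extend_transp, ← extend_mul, ih]
    rfl

/-- The first sorting step finds the largest letter at `p` with color `-c`, hence uses `t = c`. It
restores `extend π`, and sorting that is sorting `π`. -/
theorem sor_insertCycle (π : ColPerm r n) (p : Fin (n + 1)) (c : ZMod r) :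
    (insertCycle π p c).sor = sortCost p c (Fin.last n) + π.sor := by
  have hp : (insertCycle π p c).perm⁻¹ (Fin.last n) = p := by
    rw [Equiv.Perm.inv_eq_iff_eq]; simp
  rw [sor, List.finRange_succ_last, List.reverse_append, ← List.map_reverse]
  simp only [List.reverse_singleton, List.singleton_append, sortFrom, hp, insertCycle_color_same,
    neg_neg]
  rw [insertCycle, inv_mul_cancel_right, sortFrom_map_castSucc, sor]

/-! ### Left-to-right maxima -/

/-- The left-to-right maxima of the window, as triples of a place, a letter and a color. -/
def records (π : ColPerm r n) : Set (Fin n × Fin n × ZMod r) :=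
  {x | π.perm x.1 = x.2.1 ∧ π.color x.1 = x.2.2 ∧ ∀ j, j < x.1 → π.perm j < π.perm x.1}

theorem mem_records (π : ColPerm r n) (i a : Fin n) (t : ZMod r) :
    (i, a, t) ∈ π.records ↔
      π.perm i = a ∧ π.color i = t ∧ ∀ j, j < i → π.perm j < π.perm i :=
  Iff.rfl

theorem mem_Lmal_iff (π : ColPerm r n) (a : Fin n) (t : ZMod r) :
    (a, t) ∈ π.Lmal ↔ ∃ i, (i, a, t) ∈ π.records := by
  constructor
  · rintro ⟨i, h, h'⟩
    rw [window, Prod.mk.injEq] at h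
    exact ⟨i, h.1.symm, h.2.symm, h'⟩
  · rintro ⟨i, h1, h2, h3⟩
    exact ⟨i, Prod.ext h1.symm h2.symm, h3⟩

theorem mem_Lmap_iff (π : ColPerm r n) (i : Fin n) (t : ZMod r) :
    (i, t) ∈ π.Lmap ↔ ∃ a, (i, a, t) ∈ π.records := by
  constructor
  · rintro ⟨j, h, h'⟩
    rw [Prod.mk.injEq] at h
    obtain ⟨rfl, h⟩ := h
    exact ⟨π.perm i, (π.mem_records _ _ _).2 ⟨rfl, h.symm, h'⟩⟩
  · rintro ⟨_, _, h2, h3⟩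
    exact ⟨i, Prod.ext rfl h2.symm, h3⟩

/-- The largest letter among the places up to `i` is a record at some `j ≤ i`, so `π i ≤ π j ≤ f j ≤
f i`. -/
theorem mem_restricted_iff (π : ColPerm r n) {f : Fin n → Fin n} (hf : Monotone f) :
    π ∈ restricted r f ↔ ∀ i a t, (i, a, t) ∈ π.records → a ≤ f i := by
  constructor
  · intro h i a t hi
    rw [mem_records] at hi
    exact hi.1 ▸ h i
  · intro h i
    obtain ⟨j, hj, hmax⟩ := Finset.exists_max_image (Finset.Iic i) π.perm ⟨i, by simp⟩
    rw [Finset.mem_Iic] at hj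
    have hrec : (j, π.perm j, π.color j) ∈ π.records := by
      refine ⟨rfl, rfl, fun k hk => ?_⟩
      refine lt_of_le_of_ne (hmax k (by simpa using hk.le.trans hj)) fun he => ?_
      exact hk.ne (π.perm.injective he)
    exact (hmax i (by simp)).trans ((h _ _ _ hrec).trans (hf hj))

/-- If `τ` carries the largest letter at the place `p`, and agrees with `π` before `p`, then its
left-to-right maxima are the ones of `π` before `p`, and `p`. -/
theorem mem_records_of_agree {π : ColPerm r n} {τ : ColPerm r (n + 1)} {p : Fin (n + 1)}
    (hp : τ.perm p = Fin.last n)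
    (hperm : ∀ i : Fin n, i.castSucc < p → τ.perm i.castSucc = (π.perm i).castSucc)
    (hcolor : ∀ i : Fin n, i.castSucc < p → τ.color i.castSucc = π.color i)
    (i a : Fin (n + 1)) (t : ZMod r) :
    (i, a, t) ∈ τ.records ↔ (i = p ∧ a = Fin.last n ∧ t = τ.color p) ∨
      ∃ j b, i = Fin.castSucc j ∧ a = Fin.castSucc b ∧ j.castSucc < p ∧ (j, b, t) ∈ π.records := by
  simp only [mem_records]
  constructor
  · rintro ⟨h1, h2, h3⟩
    rcases lt_trichotomy i p with h | rfl | h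
    · right
      obtain ⟨j, rfl⟩ := Fin.exists_castSucc_eq.2 (h.trans_le (Fin.le_last p)).ne
      rw [hperm j h] at h1
      refine ⟨j, π.perm j, rfl, h1.symm, h, rfl, (hcolor j h).symm.trans h2, fun k hk => ?_⟩
      have := h3 k.castSucc hk
      rwa [hperm j h, hperm k (lt_trans hk h), Fin.castSucc_lt_castSucc_iff] at this
    · exact Or.inl ⟨rfl, h1.symm.trans hp, h2.symm⟩
    · have := h3 p h
      rw [hp] at this
      exact absurd this (Fin.le_last _).not_gt
  · rintro (⟨rfl, rfl, rfl⟩ | ⟨j, b, rfl, rfl, hj, rfl, rfl, h⟩)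
    · refine ⟨hp, rfl, fun k hk => ?_⟩
      rw [hp]
      refine lt_of_le_of_ne (Fin.le_last _) fun he => ?_
      exact hk.ne (τ.perm.injective (he.trans hp.symm))
    · refine ⟨hperm j hj, hcolor j hj, fun k hk => ?_⟩
      obtain ⟨k, rfl⟩ := Fin.exists_castSucc_eq.2 (hk.trans_le (Fin.le_last _)).ne
      rw [hperm j hj, hperm k (hk.trans hj)]
      exact h k hk

theorem mem_records_insertLetter (π : ColPerm r n) (p : Fin (n + 1)) (c : ZMod r)
    (i a : Fin (n + 1)) (t : ZMod r) :
    (i, a, t) ∈ (insertLetter π p c).records ↔ (i = p ∧ a = Fin.last n ∧ t = c) ∨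
      ∃ j b, i = Fin.castSucc j ∧ a = Fin.castSucc b ∧ j.castSucc < p ∧ (j, b, t) ∈ π.records := by
  rw [mem_records_of_agree (π := π) (p := p) (insertLetter_perm_same _ _ _),
    insertLetter_color_same]
  · intro i hi
    have := insertLetter_perm_succAbove π p c i
    rwa [Fin.succAbove_of_castSucc_lt _ _ hi] at this
  · intro i hi
    have := insertLetter_color_succAbove π p c i
    rwa [Fin.succAbove_of_castSucc_lt _ _ hi] at this

theorem mem_records_insertCycle (π : ColPerm r n) (p : Fin (n + 1)) (c : ZMod r)
    (i a : Fin (n + 1)) (t : ZMod r) :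
    (i, a, t) ∈ (insertCycle π p c).records ↔ (i = p ∧ a = Fin.last n ∧ t = -c) ∨
      ∃ j b, i = Fin.castSucc j ∧ a = Fin.castSucc b ∧ j.castSucc < p ∧ (j, b, t) ∈ π.records := by
  rw [mem_records_of_agree (π := π) (p := p) (insertCycle_perm_same _ _ _),
    insertCycle_color_same]
  · exact fun i hi => insertCycle_perm_castSucc _ _ _ _ hi.ne
  · exact fun i hi => insertCycle_color_castSucc _ _ _ _ hi.ne

/-! ### Right-to-left and left-to-right minima of the window -/

theorem mem_Rmil_iff (π : ColPerm r n) (a : Fin n) (t : ZMod r) :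
    (a, t) ∈ π.Rmil ↔
      ∃ i, π.perm i = a ∧ π.color i = t ∧ ∀ j, i < j → π.perm i < π.perm j := by
  simp only [Rmil, window, Set.mem_ofPred_eq, Prod.mk.injEq, and_assoc, eq_comm (a := a),
    eq_comm (a := t)]

theorem mem_Lmil_iff (π : ColPerm r n) (a : Fin n) (t : ZMod r) :
    (a, t) ∈ π.Lmil ↔
      ∃ i, π.perm i = a ∧ π.color i = t ∧ ∀ j, j < i → π.perm i < π.perm j := by
  simp only [Lmil, wordLmil, window, Set.mem_ofPred_eq, Prod.mk.injEq, and_assoc, eq_comm (a := a),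
    eq_comm (a := t)]

/-- The largest letter never prevents another letter from being a minimum, and is one itself only
when nothing follows it. -/
theorem mem_Rmil_insertLetter (π : ColPerm r n) (p : Fin (n + 1)) (c : ZMod r)
    (a : Fin (n + 1)) (t : ZMod r) :
    (a, t) ∈ (insertLetter π p c).Rmil ↔ (p = Fin.last n ∧ a = Fin.last n ∧ t = c) ∨
      ∃ b, a = Fin.castSucc b ∧ (b, t) ∈ π.Rmil := by
  simp only [mem_Rmil_iff]
  rw [Fin.exists_iff_succAbove p]
  simp only [Fin.forall_iff_succAbove p, insertLetter_perm_same, insertLetter_perm_succAbove,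
    insertLetter_color_same, insertLetter_color_succAbove, lt_irrefl, Fin.castSucc_lt_last,
    Fin.castSucc_lt_castSucc_iff, Fin.succAbove_lt_succAbove_iff, implies_true, true_and,
    IsEmpty.forall_iff]
  refine or_congr ⟨?_, ?_⟩ ⟨?_, ?_⟩
  · rintro ⟨rfl, rfl, h⟩
    refine ⟨?_, rfl, rfl⟩
    by_contra hp
    obtain ⟨q, rfl⟩ := Fin.exists_castSucc_eq.2 hp
    refine absurd (h q ?_) (Fin.le_last _).not_gt
    simp [Fin.succAbove_castSucc_self]
  · rintro ⟨rfl, rfl, rfl⟩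
    refine ⟨rfl, rfl, fun i hi => absurd hi (Fin.le_last _).not_gt⟩
  · rintro ⟨i, rfl, rfl, h⟩
    exact ⟨_, rfl, i, rfl, rfl, h⟩
  · rintro ⟨_, rfl, i, rfl, rfl, h⟩
    exact ⟨i, rfl, rfl, h⟩

theorem mem_Lmil_insertLetter (π : ColPerm r n) (p : Fin (n + 1)) (c : ZMod r)
    (a : Fin (n + 1)) (t : ZMod r) :
    (a, t) ∈ (insertLetter π p c).Lmil ↔ (p = 0 ∧ a = Fin.last n ∧ t = c) ∨
      ∃ b, a = Fin.castSucc b ∧ (b, t) ∈ π.Lmil := by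
  simp only [mem_Lmil_iff]
  rw [Fin.exists_iff_succAbove p]
  simp only [Fin.forall_iff_succAbove p, insertLetter_perm_same, insertLetter_perm_succAbove,
    insertLetter_color_same, insertLetter_color_succAbove, lt_irrefl, Fin.castSucc_lt_last,
    Fin.castSucc_lt_castSucc_iff, Fin.succAbove_lt_succAbove_iff, implies_true, true_and,
    IsEmpty.forall_iff]
  refine or_congr ⟨?_, ?_⟩ ⟨?_, ?_⟩
  · rintro ⟨rfl, rfl, h⟩
    refine ⟨?_, rfl, rfl⟩
    by_contra hp
    obtain ⟨q, rfl⟩ := Fin.exists_succ_eq.2 hp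
    refine absurd (h q ?_) (Fin.le_last _).not_gt
    simp [Fin.succAbove_succ_self]
  · rintro ⟨rfl, rfl, rfl⟩
    refine ⟨rfl, rfl, fun i hi => absurd hi (Fin.zero_le _).not_gt⟩
  · rintro ⟨i, rfl, rfl, h⟩
    exact ⟨_, rfl, i, rfl, rfl, h⟩
  · rintro ⟨_, rfl, i, rfl, rfl, h⟩
    exact ⟨i, rfl, rfl, h⟩

/-! ### The length as a sum over the places -/

/-- The number of smaller letters before the place `i`. -/
def smallerBefore (π : ColPerm r n) (i : Fin n) : ℕ :=
  (Finset.univ.filter fun k => k < i ∧ π.perm k < π.perm i).card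

/-- The number of generators needed to move the letter `a` with color `t` into the position `q`
(counted from `0`) among the letters that are at most `a`. -/
def moveCost (q : ℕ) (t : ZMod r) (a : ℕ) : ℕ := (a - q) + if t = 0 then 0 else 2 * q + t.val

/-- The contribution of the place `i` to the length. -/
def placeCost (π : ColPerm r n) (i : Fin n) : ℕ :=
  moveCost (π.smallerBefore i) (π.color i) (π.perm i)

/-- The combinatorial formula for the length. -/
def lengthSum (π : ColPerm r n) : ℕ := ∑ i, π.placeCost i

theorem sortCost_eq_moveCost (i : Fin n) (t : ZMod r) (j : Fin n) :
    sortCost i t j = moveCost i t j := rfl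

/-- All `p` letters before the new one are smaller, and the new letter is never counted in
`smallerBefore` of another. -/
theorem lengthSum_insertLetter (π : ColPerm r n) (p : Fin (n + 1)) (c : ZMod r) :
    (insertLetter π p c).lengthSum = sortCost p c (Fin.last n) + π.lengthSum := by
  have hp : (insertLetter π p c).smallerBefore p = p := by
    have : (Finset.univ.filter fun k => k < p ∧
        (insertLetter π p c).perm k < (insertLetter π p c).perm p) = Finset.Iio p := by
      ext k
      simp only [Finset.mem_filter, Finset.mem_univ, true_and, Finset.mem_Iio,
        insertLetter_perm_same, and_iff_left_iff_imp]
      intro hk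
      refine lt_of_le_of_ne (Fin.le_last _) fun he => hk.ne ?_
      exact (insertLetter π p c).perm.injective (by rw [he, insertLetter_perm_same])
    rw [smallerBefore, this, Fin.card_Iio]
  have hi (i : Fin n) :
      (insertLetter π p c).smallerBefore (p.succAbove i) = π.smallerBefore i := by
    simp only [smallerBefore, Finset.card_filter]
    rw [Fin.sum_univ_succAbove _ p]
    simp [Fin.le_last, Fin.succAbove_lt_succAbove_iff]
  rw [lengthSum, Fin.sum_univ_succAbove _ p, sortCost_eq_moveCost, lengthSum]
  simp only [placeCost, hp, hi]
  simp

/-- This keeps the truncated subtraction in `moveCost` exact. -/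
theorem smallerBefore_le (π : ColPerm r n) (i : Fin n) : π.smallerBefore i ≤ π.perm i := by
  rw [← Fin.card_Iio (π.perm i)]
  refine Finset.card_le_card_of_injOn π.perm (fun k hk => ?_) π.perm.injective.injOn
  simpa using (Finset.mem_filter.1 hk).2.2

theorem lengthSum_one : (1 : ColPerm r n).lengthSum = 0 := by
  refine Finset.sum_eq_zero fun i _ => ?_
  have : (1 : ColPerm r n).smallerBefore i = i := by
    rw [← Fin.card_Iio i, smallerBefore]
    congr 1
    ext k
    simp
  simp [placeCost, moveCost, this]

/-! #### Exchanging two neighbors -/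

/-- The generator that exchanges the letters at the places `i` and `j`, for neighbors `i`, `j`. -/
def exchange (i j : Fin n) : ColPerm r n := ⟨Equiv.swap i j, 0⟩

theorem mul_exchange_exchange (π : ColPerm r n) (i j : Fin n) :
    π * exchange i j * exchange i j = π := by
  apply ext_apply <;> intro k <;> simp [exchange]

theorem swap_lt_swap_iff {i j k m : Fin n} (hij : (i : ℕ) + 1 = j) (h : ¬(m = i ∧ k = j))
    (h' : ¬(m = j ∧ k = i)) : Equiv.swap i j m < Equiv.swap i j k ↔ m < k := by
  simp only [Equiv.swap_apply_def]
  split_ifs <;> simp only [Fin.lt_def, Fin.ext_iff] at * <;> omega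

theorem smallerBefore_mul_exchange (π : ColPerm r n) (i j k : Fin n) :
    (π * exchange i j).smallerBefore (Equiv.swap i j k) =
      (Finset.univ.filter fun m =>
        Equiv.swap i j m < Equiv.swap i j k ∧ π.perm m < π.perm k).card := by
  simp only [smallerBefore, Finset.card_filter]
  rw [← Equiv.sum_comp (Equiv.swap i j)]
  simp [exchange]

theorem placeCost_mul_exchange (π : ColPerm r n) (i j k : Fin n) :
    (π * exchange i j).placeCost (Equiv.swap i j k) =
      moveCost ((π * exchange i j).smallerBefore (Equiv.swap i j k)) (π.color k) (π.perm k) := by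
  simp [placeCost, exchange]

theorem smallerBefore_mul_exchange_of_ne (π : ColPerm r n) {i j k : Fin n}
    (hij : (i : ℕ) + 1 = j) (h : π.perm i < π.perm j) (hk : k ≠ j) :
    (π * exchange i j).smallerBefore (Equiv.swap i j k) = π.smallerBefore k := by
  rw [smallerBefore_mul_exchange, smallerBefore]
  congr 1
  refine Finset.filter_congr fun m _ => and_congr_left fun hm => ?_
  refine swap_lt_swap_iff hij (fun h' => hk h'.2) ?_
  rintro ⟨rfl, rfl⟩
  exact h.not_gt hm

theorem smallerBefore_mul_exchange_right (π : ColPerm r n) {i j : Fin n}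
    (hij : (i : ℕ) + 1 = j) (h : π.perm i < π.perm j) :
    (π * exchange i j).smallerBefore (Equiv.swap i j j) + 1 = π.smallerBefore j := by
  rw [smallerBefore_mul_exchange, smallerBefore, ← Finset.card_insert_of_notMem (a := i)]
  · congr 1
    ext m
    simp only [Finset.mem_insert, Finset.mem_filter, Finset.mem_univ, true_and]
    by_cases hm : m = i
    · subst hm
      have : m < j := Fin.lt_def.2 (by omega)
      simp [h, this]
    · rw [swap_lt_swap_iff hij (fun h' => hm h'.1)]
      · simp [hm]
      · rintro ⟨-, rfl⟩
        exact h.false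
  · have : ¬j < i := fun hji => by rw [Fin.lt_def] at hji; omega
    simp [this]

/-- Only the larger of the two neighbors changes its cost: it loses one smaller letter before it.
This adds one to `a - q`, and takes two from `2 * q` if the letter is colored. -/
theorem lengthSum_mul_exchange (π : ColPerm r n) {i j : Fin n} (hij : (i : ℕ) + 1 = j)
    (h : π.perm i < π.perm j) :
    (π.color j = 0 → (π * exchange i j).lengthSum = π.lengthSum + 1) ∧
      (π.color j ≠ 0 → (π * exchange i j).lengthSum + 1 = π.lengthSum) := by
  have e1 : (π * exchange i j).lengthSum = (π * exchange i j).placeCost (Equiv.swap i j j) +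
      ∑ k ∈ Finset.univ.erase j, π.placeCost k := by
    rw [lengthSum, ← Equiv.sum_comp (Equiv.swap i j),
      ← Finset.add_sum_erase _ _ (Finset.mem_univ j)]
    refine congrArg _ (Finset.sum_congr rfl fun k hk => ?_)
    rw [placeCost_mul_exchange,
      smallerBefore_mul_exchange_of_ne π hij h (Finset.ne_of_mem_erase hk), placeCost]
  have e2 : π.lengthSum = π.placeCost j + ∑ k ∈ Finset.univ.erase j, π.placeCost k :=
    (Finset.add_sum_erase _ _ (Finset.mem_univ j)).symm
  rw [e1, e2, placeCost_mul_exchange, placeCost]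
  have h1 := smallerBefore_mul_exchange_right π hij h
  have h2 := π.smallerBefore_le j
  constructor <;> intro hz <;> simp only [moveCost, hz, if_true, if_false] <;> omega

/-! #### Coloring the first letter -/

section Color

variable [NeZero n]

/-- The element that adds `x` to the color of the first letter. -/
def colorFirst (x : ZMod r) : ColPerm r n := ⟨1, Pi.single 0 x⟩

/-- The first letter has no letter before it, so its color contributes exactly its value. The
additive form avoids subtraction in `ℕ`. -/
theorem lengthSum_mul_colorFirst (π : ColPerm r n) (x : ZMod r) :
    (π * colorFirst x).lengthSum + (π.color 0).val = π.lengthSum + (x + π.color 0).val := by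
  have hsb (i : Fin n) : (π * colorFirst x).smallerBefore i = π.smallerBefore i := rfl
  have h0 : π.smallerBefore 0 = 0 := by simp [smallerBefore]
  have hm (z : ZMod r) (a : ℕ) : moveCost 0 z a = a + z.val := by
    by_cases hz : z = 0 <;> simp [moveCost, hz]
  have e1 : (π * colorFirst x).lengthSum = (π.perm 0 + (x + π.color 0).val) +
      ∑ k ∈ Finset.univ.erase 0, π.placeCost k := by
    rw [lengthSum, ← Finset.add_sum_erase _ _ (Finset.mem_univ 0)]
    congr 1
    · rw [placeCost, hsb, h0, hm]
      simp [colorFirst]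
    · refine Finset.sum_congr rfl fun k hk => ?_
      rw [placeCost, hsb, placeCost]
      simp [colorFirst, Pi.single_eq_of_ne (Finset.ne_of_mem_erase hk)]
  have e2 : π.lengthSum = (π.perm 0 + (π.color 0).val) +
      ∑ k ∈ Finset.univ.erase 0, π.placeCost k := by
    rw [lengthSum, ← Finset.add_sum_erase _ _ (Finset.mem_univ 0), placeCost, h0, hm]
  omega

theorem lengthSum_mul_generator_le [NeZero r] (π : ColPerm r n) {s : ColPerm r n}
    (hs : s ∈ generators r n) : (π * s).lengthSum ≤ π.lengthSum + 1 := by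
  rcases hs with rfl | ⟨i, j, hij, rfl⟩
  · have h1 := lengthSum_mul_colorFirst π 1
    have h2 := ZMod.val_add_le 1 (π.color 0)
    -- The value is `0` when `r = 1`.
    have h3 : (1 : ZMod r).val ≤ 1 := by
      rw [ZMod.val_one_eq_one_mod]; exact Nat.mod_le _ _
    change (π * colorFirst 1).lengthSum ≤ _
    omega
  · change (π * exchange i j).lengthSum ≤ _
    have hne : i ≠ j := fun h => by simp [h] at hij
    rcases lt_or_gt_of_ne (π.perm.injective.ne hne) with h | h
    · have := lengthSum_mul_exchange π hij h
      by_cases hz : π.color j = 0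
      · exact (this.1 hz).le
      · have := this.2 hz; omega
    · have := lengthSum_mul_exchange (π * exchange i j) hij (by simpa [exchange] using h)
      rw [mul_exchange_exchange] at this
      by_cases hz : (π * exchange i j).color j = 0
      · have := this.1 hz; omega
      · exact (this.2 hz).ge

/-- The hypotheses say that no generator can be split off on the right with a drop in `lengthSum`.
Being uncolored then spreads from the first letter: an uncolored letter forces an ascent, and an
ascent forces the next letter to be uncolored. The word is thus increasing and uncolored. -/
theorem eq_one_of_no_descent {π : ColPerm r n} (h0 : π.color 0 = 0)
    (hlt : ∀ i j : Fin n, (i : ℕ) + 1 = j → π.perm i < π.perm j → π.color j = 0)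
    (hgt : ∀ i j : Fin n, (i : ℕ) + 1 = j → π.perm j < π.perm i → π.color i ≠ 0) : π = 1 := by
  have key (i j : Fin n) (hij : (i : ℕ) + 1 = j) (hi : π.color i = 0) : π.perm i < π.perm j := by
    have hne : i ≠ j := fun h => by simp [h] at hij
    exact (lt_or_gt_of_ne (π.perm.injective.ne hne)).resolve_right fun h => hgt i j hij h hi
  have hcolor : ∀ (k : ℕ) (hk : k < n), π.color ⟨k, hk⟩ = 0 := by
    intro k
    induction k with
    | zero => exact fun _ => h0
    | succ k ih =>
      intro hk
      have hk' := ih (by omega)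
      exact hlt ⟨k, by omega⟩ ⟨k + 1, hk⟩ rfl (key _ _ rfl hk')
  have hmono : StrictMono π.perm := by
    obtain ⟨m, rfl⟩ := Nat.exists_eq_succ_of_ne_zero (NeZero.ne n)
    exact Fin.strictMono_iff_lt_succ.2 fun i => key _ _ (by simp) (hcolor _ _)
  refine ext_apply (fun i => ?_) fun i => hcolor i i.2
  exact congrFun ((hmono.range_inj strictMono_id).1 (by simp [π.perm.surjective.range_eq])) i

theorem exists_descent [NeZero r] {π : ColPerm r n} (hπ : π ≠ 1) :
    ∃ s ∈ generators r n, ∃ τ : ColPerm r n, π = τ * s ∧ τ.lengthSum + 1 = π.lengthSum := by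
  by_contra! hcon
  refine hπ (eq_one_of_no_descent ?_ ?_ ?_)
  · by_contra h0
    -- Unlike the exchanges, `s_0` need not be an involution, so its inverse `colorFirst (-1)` is
    -- used.
    refine hcon _ (Or.inl rfl) (π * colorFirst (-1)) ?_ ?_
    · change π = π * colorFirst (-1) * colorFirst 1
      refine ext_apply (fun i => by simp [colorFirst]) fun i => ?_
      by_cases hi : i = 0 <;> simp [colorFirst, hi]
    · have h1 := lengthSum_mul_colorFirst π (-1)
      have hr : r ≠ 1 := by
        rintro rfl
        exact h0 (Subsingleton.elim _ _)
      have h2 : (-1 + π.color 0).val = (π.color 0).val - 1 := by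
        rw [neg_add_eq_sub, ZMod.val_sub, ZMod.val_one'' hr]
        rw [ZMod.val_one'' hr]
        exact Nat.one_le_iff_ne_zero.2 ((ZMod.val_ne_zero _).2 h0)
      have h3 := (ZMod.val_ne_zero _).2 h0
      omega
  · intro i j hij h
    by_contra hz
    exact hcon (exchange i j) (Or.inr ⟨i, j, hij, rfl⟩) (π * exchange i j)
      (mul_exchange_exchange _ _ _).symm ((lengthSum_mul_exchange π hij h).2 hz)
  · intro i j hij h hz
    have := lengthSum_mul_exchange (π * exchange i j) hij (by simpa [exchange] using h)
    rw [mul_exchange_exchange] at this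
    exact hcon (exchange i j) (Or.inr ⟨i, j, hij, rfl⟩) (π * exchange i j)
      (mul_exchange_exchange _ _ _).symm (this.1 (by simpa [exchange] using hz)).symm

theorem exists_list_prod_eq [NeZero r] (π : ColPerm r n) :
    ∃ L : List (ColPerm r n), (∀ s ∈ L, s ∈ generators r n) ∧ L.prod = π ∧
      L.length = π.lengthSum := by
  induction hk : π.lengthSum generalizing π with
  | zero =>
    refine ⟨[], by simp, ?_, rfl⟩
    by_contra h
    obtain ⟨s, -, τ, -, hτ⟩ := exists_descent (π := π) (fun h' => h h'.symm)
    omega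
  | succ k ih =>
    have hπ : π ≠ 1 := by
      rintro rfl
      rw [lengthSum_one] at hk
      omega
    obtain ⟨s, hs, τ, rfl, hτ⟩ := exists_descent hπ
    obtain ⟨L, hL, hprod, hlen⟩ := ih τ (by omega)
    refine ⟨L ++ [s], ?_, by simp [hprod], by simp [hlen]⟩
    intro x hx
    rcases List.mem_append.1 hx with hx | hx
    · exact hL x hx
    · rwa [List.mem_singleton.1 hx]

theorem lengthSum_list_prod_le [NeZero r] (L : List (ColPerm r n))
    (hL : ∀ s ∈ L, s ∈ generators r n) : L.prod.lengthSum ≤ L.length := by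
  induction L using List.reverseRecOn with
  | nil => simp [lengthSum_one]
  | append_singleton L s ih =>
    have h1 := ih fun x hx => hL x (by simp [hx])
    have h2 := lengthSum_mul_generator_le L.prod (hL s (by simp))
    simp only [List.prod_append, List.prod_singleton, List.length_append, List.length_singleton]
    omega

theorem length_eq_lengthSum [NeZero r] (π : ColPerm r n) : π.length = π.lengthSum := by
  refine le_antisymm (Nat.sInf_le (exists_list_prod_eq π)) ?_
  refine le_csInf ⟨_, exists_list_prod_eq π⟩ ?_
  rintro _ ⟨L, hL, rfl, rfl⟩
  exact lengthSum_list_prod_le L hL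

end Color

/-! ### The colored cycle set -/

theorem mem_Cyc_iff (π : ColPerm r n) (a : Fin n) (t : ZMod r) [DecidableRel π.perm.SameCycle] :
    (a, t) ∈ π.Cyc ↔ (∀ i, π.perm.SameCycle a i → a ≤ i) ∧
      t = ∑ i, if π.perm.SameCycle a i then π.color i else 0 := by
  rw [← Finset.sum_filter]
  simp only [Cyc, Set.mem_ofPred_eq]

theorem sameCycle_map {α β : Type*} [Finite α] {σ : Equiv.Perm α} {τ : Equiv.Perm β} (g : α → β)
    (hg : ∀ x, τ.SameCycle (g x) (g (σ x))) {x y : α} (h : σ.SameCycle x y) :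
    τ.SameCycle (g x) (g y) := by
  obtain ⟨k, rfl⟩ := h.exists_nat_pow_eq
  clear h
  induction k with
  | zero => exact .refl _ _
  | succ k ih =>
    rw [pow_succ']
    exact ih.trans (hg _)

theorem insertCycle_perm_last_last (π : ColPerm r n) (c : ZMod r) :
    (insertCycle π (Fin.last n) c).perm (Fin.last n) = Fin.last n :=
  insertCycle_perm_same _ _ _

theorem sameCycle_insertCycle_iff (π : ColPerm r n) (p : Fin (n + 1)) (c : ZMod r) (a b : Fin n) :
    (insertCycle π p c).perm.SameCycle a.castSucc b.castSucc ↔ π.perm.SameCycle a b := by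
  constructor
  · intro h
    -- Collapse the last letter to `d`. If it was spliced in after `q`, then `d = q` makes each step
    -- a step of `π` or a stay; if it is a fixed point, any `d` will do.
    have key (d : Fin n) (hd : ∀ q, p = Fin.castSucc q → d = q) :=
      sameCycle_map (τ := π.perm) (Fin.lastCases d id : Fin (n + 1) → Fin n) (fun x => by
        refine Fin.lastCases ?_ (fun i => ?_) x
        · induction p using Fin.lastCases with
          | last => rw [insertCycle_perm_last_last]
          | cast q =>
            rw [insertCycle_perm_last, hd q rfl]
            simp [Equiv.Perm.sameCycle_apply_right, Equiv.Perm.SameCycle.refl]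
        · by_cases hi : i.castSucc = p
          · subst hi
            rw [insertCycle_perm_same, hd i rfl]
            simp [Equiv.Perm.SameCycle.refl]
          · rw [insertCycle_perm_castSucc _ _ _ _ hi]
            simp [Equiv.Perm.sameCycle_apply_right, Equiv.Perm.SameCycle.refl]) h
    induction p using Fin.lastCases with
    | last => simpa using key a fun q hq => absurd hq.symm (Fin.castSucc_ne_last q)
    | cast q => simpa using key q fun q' hq => Fin.castSucc_injective _ hq
  · refine sameCycle_map _ fun i => ?_
    by_cases hi : i.castSucc = p
    · subst hi
      rw [← insertCycle_perm_last π c, ← insertCycle_perm_same π i.castSucc c,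
        Equiv.Perm.sameCycle_apply_right, Equiv.Perm.sameCycle_apply_right]
    · rw [← insertCycle_perm_castSucc _ _ c _ hi, Equiv.Perm.sameCycle_apply_right]

theorem sameCycle_insertCycle_last_iff (π : ColPerm r n) (p : Fin n) (c : ZMod r) (a : Fin n) :
    (insertCycle π p.castSucc c).perm.SameCycle a.castSucc (Fin.last n) ↔
      π.perm.SameCycle a p := by
  rw [← insertCycle_perm_same π p.castSucc c, Equiv.Perm.sameCycle_apply_right,
    sameCycle_insertCycle_iff]

theorem sameCycle_insertCycle_last_left_iff (π : ColPerm r n) (c : ZMod r) (b : Fin (n + 1)) :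
    (insertCycle π (Fin.last n) c).perm.SameCycle (Fin.last n) b ↔ b = Fin.last n := by
  constructor
  · intro h
    exact (h.eq_of_left (insertCycle_perm_last_last π c)).symm
  · rintro rfl
    exact .refl _ _

open Classical in
theorem sum_color_insertCycle (π : ColPerm r n) (p : Fin (n + 1)) (c : ZMod r) (a : Fin n) :
    (∑ i, if (insertCycle π p c).perm.SameCycle a.castSucc i then (insertCycle π p c).color i
      else 0) = ∑ i, if π.perm.SameCycle a i then π.color i else 0 := by
  rw [Fin.sum_univ_castSucc]
  simp only [sameCycle_insertCycle_iff]
  induction p using Fin.lastCases with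
  | last =>
    rw [if_neg (fun h => Fin.castSucc_ne_last a
      ((sameCycle_insertCycle_last_left_iff π c _).1 h.symm)), add_zero]
    exact Finset.sum_congr rfl fun i _ => by
      rw [insertCycle_color_castSucc _ _ _ _ (Fin.castSucc_ne_last i)]
  | cast p =>
    simp only [sameCycle_insertCycle_last_iff, insertCycle_color_last]
    -- The color at `p` drops from `π.color p` to `-c`; this correction cancels the color of the
    -- last letter.
    have (i : Fin n) : (if π.perm.SameCycle a i then (insertCycle π p.castSucc c).color i.castSucc
        else 0) = (if π.perm.SameCycle a i then π.color i else 0) +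
          if i = p then (if π.perm.SameCycle a p then -(c + π.color p) else 0) else 0 := by
      by_cases hi : i = p
      · subst hi
        rw [insertCycle_color_same, if_pos rfl]
        split_ifs <;> ring
      · rw [insertCycle_color_castSucc _ _ _ _ (by simpa using hi)]
        simp [hi]
    simp only [this, Finset.sum_add_distrib, Finset.sum_ite_eq', Finset.mem_univ, if_true]
    split_ifs <;> ring

theorem mem_Cyc_insertCycle (π : ColPerm r n) (p : Fin (n + 1)) (c : ZMod r)
    (a : Fin (n + 1)) (t : ZMod r) :
    (a, t) ∈ (insertCycle π p c).Cyc ↔ (p = Fin.last n ∧ a = Fin.last n ∧ t = -c) ∨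
      ∃ b, a = Fin.castSucc b ∧ (b, t) ∈ π.Cyc := by
  classical
  induction a using Fin.lastCases with
  | last =>
    rw [mem_Cyc_iff]
    induction p using Fin.lastCases with
    | last => simp [sameCycle_insertCycle_last_left_iff, (Fin.castSucc_ne_last _).symm]
    | cast p =>
      simp only [Fin.castSucc_ne_last, (Fin.castSucc_ne_last _).symm, false_and, exists_false,
        or_false, iff_false, not_and]
      intro h
      have := h p.castSucc (((sameCycle_insertCycle_last_iff π p c p).2 (.refl _ _)).symm)
      exact absurd this (Fin.castSucc_lt_last p).not_ge
  | cast a =>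
    have : (∀ i, (insertCycle π p c).perm.SameCycle a.castSucc i → a.castSucc ≤ i) ↔
        ∀ i, π.perm.SameCycle a i → a ≤ i := by
      constructor
      · intro h i hi
        exact h i.castSucc ((sameCycle_insertCycle_iff π p c a i).2 hi)
      · intro h i
        refine Fin.lastCases (fun _ => Fin.le_last _) (fun i hi => ?_) i
        exact h i ((sameCycle_insertCycle_iff π p c a i).1 hi)
    rw [mem_Cyc_iff, this, sum_color_insertCycle, ← mem_Cyc_iff]
    simp [Fin.castSucc_ne_last]

/-! ### Left-to-right minima of the first cycle -/

section Lmic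

/-- The letter `a` with color `t` occurs in the word `π(1) π²(1) ⋯` in a place such that all
letters before it are larger than `m`. -/
inductive Reach [NeZero n] (π : ColPerm r n) (m : Fin n) : Fin n → ZMod r → Prop
  | start : Reach π m (π.perm 0) (π.color 0)
  | step {a : Fin n} {t : ZMod r} :
      Reach π m a t → m < a → Reach π m (π.perm a) (t + π.color a)

/-- `Reach` forgets positions in the word, which shift when a letter is spliced in. Its guard `m <
a` fails at the letter `0`, so the periodic word is never followed beyond its first return there. -/
theorem reach_iff [NeZero n] (π : ColPerm r n) (m a : Fin n) (t : ZMod r) :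
    π.Reach m a t ↔ ∃ k : ℕ, (a, t) = (π ^ (k + 1)).window 0 ∧
      ∀ j, j < k → m < ((π ^ (j + 1)).window 0).1 := by
  have hsucc (k : ℕ) : (π ^ (k + 1)).window 0 =
      (π.perm ((π ^ k).window 0).1, ((π ^ k).window 0).2 + π.color ((π ^ k).window 0).1) := by
    rw [pow_succ']; rfl
  constructor
  · intro h
    induction h with
    | start => exact ⟨0, by simp [window], by simp⟩
    | @step a t _ hm ih =>
      obtain ⟨k, hk, hlt⟩ := ih
      refine ⟨k + 1, by rw [hsucc, ← hk], fun j hj => ?_⟩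
      rcases (Nat.lt_succ_iff_lt_or_eq.1 hj) with hj | rfl
      · exact hlt j hj
      · rwa [← hk]
  · rintro ⟨k, hk, hlt⟩
    induction k generalizing a t with
    | zero =>
      simp only [window, zero_add, pow_one, Prod.mk.injEq] at hk
      rw [hk.1, hk.2]
      exact .start
    | succ k ih =>
      rw [hsucc, Prod.mk.injEq] at hk
      rw [hk.1, hk.2]
      exact .step (ih _ _ rfl fun j hj => hlt j (by omega)) (hlt k (by omega))

theorem mem_Lmic_iff [NeZero n] (π : ColPerm r n) (a : Fin n) (t : ZMod r) :
    (a, t) ∈ π.Lmic ↔ π.Reach a a t := by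
  rw [reach_iff]
  refine exists_congr fun k => and_congr_right fun hk => ?_
  dsimp only at hk ⊢
  rw [← hk]

theorem reach_last_iff (π : ColPerm r (n + 1)) (a : Fin (n + 1)) (t : ZMod r) :
    π.Reach (Fin.last n) a t ↔ a = π.perm 0 ∧ t = π.color 0 := by
  constructor
  · intro h
    cases h with
    | start => exact ⟨rfl, rfl⟩
    | step _ h => exact absurd h (Fin.le_last _).not_gt
  · rintro ⟨rfl, rfl⟩
    exact .start

theorem last_mem_Lmic_insertCycle_iff (π : ColPerm r n) (p : Fin (n + 1)) (c t : ZMod r) :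
    (Fin.last n, t) ∈ (insertCycle π p c).Lmic ↔ p = 0 ∧ t = -c := by
  rw [mem_Lmic_iff, reach_last_iff, ← insertCycle_perm_same π p c, Equiv.apply_eq_iff_eq]
  refine and_congr_right ?_
  rintro rfl
  rw [insertCycle_color_same]

variable [NeZero n]

/-- At the last letter the invariant says that the walk of `π` is about to leave `q` with color `t +
c`. Either `q` was reached above the threshold, or `q = 0` and the word is just starting, where no
guard applies. -/
theorem Reach.of_insertCycle {π : ColPerm r n} {p : Fin (n + 1)} {c : ZMod r} {m : Fin n}
    {x : Fin (n + 1)} {t : ZMod r} (h : (insertCycle π p c).Reach m.castSucc x t) :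
    (∃ b, x = Fin.castSucc b ∧ π.Reach m b t) ∨
      (x = Fin.last n ∧ ∃ q, p = Fin.castSucc q ∧
        ((q = 0 ∧ t + c = 0) ∨ (m < q ∧ π.Reach m q (t + c)))) := by
  induction h with
  | start =>
    rw [← Fin.castSucc_zero']
    by_cases hp : (0 : Fin n).castSucc = p
    · subst hp
      exact Or.inr ⟨insertCycle_perm_same _ _ _, 0, rfl, Or.inl ⟨rfl, by simp⟩⟩
    · rw [insertCycle_perm_castSucc _ _ _ _ hp, insertCycle_color_castSucc _ _ _ _ hp]
      exact Or.inl ⟨_, rfl, .start⟩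
  | step _ hm ih =>
    rcases ih with ⟨b, rfl, hb⟩ | ⟨rfl, q, rfl, hq⟩
    · by_cases hp : b.castSucc = p
      · subst hp
        refine Or.inr ⟨insertCycle_perm_same _ _ _, b, rfl, Or.inr ⟨hm, ?_⟩⟩
        simpa using hb
      · rw [insertCycle_perm_castSucc _ _ _ _ hp, insertCycle_color_castSucc _ _ _ _ hp]
        exact Or.inl ⟨_, rfl, .step hb hm⟩
    · rw [insertCycle_perm_last, insertCycle_color_last, ← add_assoc]
      refine Or.inl ⟨_, rfl, ?_⟩
      rcases hq with ⟨rfl, ht⟩ | ⟨hmq, hq⟩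
      · rw [ht, zero_add]
        exact .start
      · exact .step hq hmq

theorem Reach.insertCycle {π : ColPerm r n} (p : Fin (n + 1)) (c : ZMod r) {m b : Fin n}
    {t : ZMod r} (h : π.Reach m b t) :
    (insertCycle π p c).Reach m.castSucc b.castSucc t := by
  induction h with
  | start =>
    by_cases hp : (0 : Fin n).castSucc = p
    · subst hp
      have h1 : (π.insertCycle (0 : Fin n).castSucc c).Reach m.castSucc _ _ := .start
      rw [← Fin.castSucc_zero', insertCycle_perm_same, insertCycle_color_same] at h1
      have h2 := h1.step (Fin.castSucc_lt_last m)
      -- The detour through the last letter passes every guard, and its colors `-c` and `c + π.color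
      -- 0` restore the original one.
      rwa [insertCycle_perm_last, insertCycle_color_last, neg_add_cancel_left] at h2
    · rw [← insertCycle_perm_castSucc _ _ c _ hp, ← insertCycle_color_castSucc _ _ c _ hp,
        Fin.castSucc_zero']
      exact .start
  | @step a t _ hm ih =>
    by_cases hp : a.castSucc = p
    · subst hp
      have h1 := ih.step hm
      rw [insertCycle_perm_same, insertCycle_color_same] at h1
      have h2 := h1.step (Fin.castSucc_lt_last m)
      rwa [insertCycle_perm_last, insertCycle_color_last, add_assoc, neg_add_cancel_left] at h2
    · rw [← insertCycle_perm_castSucc _ _ c _ hp, ← insertCycle_color_castSucc _ _ c _ hp]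
      exact .step ih hm

theorem mem_Lmic_insertCycle (π : ColPerm r n) (p : Fin (n + 1)) (c : ZMod r)
    (a : Fin (n + 1)) (t : ZMod r) :
    (a, t) ∈ (insertCycle π p c).Lmic ↔ (p = 0 ∧ a = Fin.last n ∧ t = -c) ∨
      ∃ b, a = Fin.castSucc b ∧ (b, t) ∈ π.Lmic := by
  induction a using Fin.lastCases with
  | last => simp [last_mem_Lmic_insertCycle_iff, (Fin.castSucc_ne_last _).symm]
  | cast a =>
    have : (insertCycle π p c).Reach a.castSucc a.castSucc t ↔ π.Reach a a t := by
      refine ⟨fun h => ?_, .insertCycle p c⟩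
      rcases h.of_insertCycle with ⟨b, hb, h⟩ | ⟨hl, -⟩
      · rwa [← Fin.castSucc_injective _ hb] at h
      · exact absurd hl (Fin.castSucc_ne_last a)
    simp [mem_Lmic_iff, this, Fin.castSucc_ne_last]

end Lmic

/-! ### The bijection -/

/-- `τ` has the statistics of the sorting side which correspond to those of `π` on the length side,
with all colors negated. -/
structure Corresponds (π τ : ColPerm r n) : Prop where
  sor_eq : τ.sor = π.lengthSum
  records_iff : ∀ i a t, (i, a, -t) ∈ τ.records ↔ (i, a, t) ∈ π.records
  cyc_iff : ∀ a t, (a, -t) ∈ τ.Cyc ↔ (a, t) ∈ π.Rmil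
  lmic_iff : ∀ [NeZero n], ∀ a t, (a, -t) ∈ τ.Lmic ↔ (a, t) ∈ π.Lmil

theorem Corresponds.insert {π τ : ColPerm r n} (h : Corresponds π τ) (p : Fin (n + 1))
    (c : ZMod r) : Corresponds (insertLetter π p c) (insertCycle τ p c) where
  sor_eq := by rw [sor_insertCycle, lengthSum_insertLetter, h.sor_eq]
  records_iff i a t := by
    simp only [mem_records_insertCycle, mem_records_insertLetter, h.records_iff, neg_inj]
  cyc_iff a t := by
    simp only [mem_Cyc_insertCycle, mem_Rmil_insertLetter, h.cyc_iff, neg_inj]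
  lmic_iff {_} a t := by
    -- For `n = 0` there is no first letter, so `Lmic` of `τ` is not available; the single letter is
    -- treated directly.
    rcases Nat.eq_zero_or_pos n with rfl | hn
    · obtain rfl : a = Fin.last 0 := Subsingleton.elim (α := Fin 1) _ _
      rw [last_mem_Lmic_insertCycle_iff, mem_Lmil_insertLetter, neg_inj]
      simp
    · have : NeZero n := ⟨hn.ne'⟩
      simp only [mem_Lmic_insertCycle, mem_Lmil_insertLetter, h.lmic_iff, neg_inj]

theorem exists_equiv_corresponds (r n : ℕ) [NeZero r] :
    ∃ φ : ColPerm r n ≃ ColPerm r n, ∀ π, Corresponds π (φ π) := by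
  induction n with
  | zero =>
    refine ⟨Equiv.refl _, fun π => ⟨rfl, fun i => i.elim0, fun i => i.elim0, fun i => i.elim0⟩⟩
  | succ n ih =>
    obtain ⟨φ, hφ⟩ := ih
    refine ⟨insertLetterEquiv.symm.trans
      ((φ.prodCongr (Equiv.refl _)).trans insertCycleEquiv), fun π => ?_⟩
    obtain ⟨⟨π, p, c⟩, rfl⟩ := insertLetterEquiv.surjective π
    rw [Equiv.trans_apply, Equiv.symm_apply_apply]
    exact (hφ π).insert p c

theorem Corresponds.mem_restricted_iff {π τ : ColPerm r n} (h : Corresponds π τ)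
    {f : Fin n → Fin n} (hf : Monotone f) : τ ∈ restricted r f ↔ π ∈ restricted r f := by
  rw [ColPerm.mem_restricted_iff _ hf, ColPerm.mem_restricted_iff _ hf]
  refine forall_congr' fun i => forall_congr' fun a => ?_
  -- Negating the quantified color matches the sign in `records_iff`.
  rw [← (Equiv.neg (ZMod r)).forall_congr_right]
  simp [h.records_iff]

end ColPerm

theorem theorem4p3 (r n : ℕ) [NeZero r] [NeZero n] (f : Fin n → Fin n) (hf : Monotone f)
    (k : ℕ) (A B C D : ZMod r → Set (Fin n)) :
    Set.ncard {π : ColPerm r n | π ∈ ColPerm.restricted r f ∧ π.length = k ∧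
        ∀ t : ZMod r, ColPerm.colorPart π.Rmil t = A t ∧ ColPerm.colorPart π.Lmil t = B t ∧
          ColPerm.colorPart π.Lmal t = C t ∧ ColPerm.colorPart π.Lmap t = D t} =
      Set.ncard {π : ColPerm r n | π ∈ ColPerm.restricted r f ∧ π.sor = k ∧
        ∀ t : ZMod r, ColPerm.colorPart π.Cyc (-t) = A t ∧ ColPerm.colorPart π.Lmic (-t) = B t ∧
          ColPerm.colorPart π.Lmal (-t) = C t ∧ ColPerm.colorPart π.Lmap (-t) = D t} := by
  obtain ⟨φ, hφ⟩ := ColPerm.exists_equiv_corresponds r n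
  refine Nat.card_congr (φ.subtypeEquiv fun π => ?_)
  have h := hφ π
  have hLmal (a : Fin n) (t : ZMod r) : (a, -t) ∈ (φ π).Lmal ↔ (a, t) ∈ π.Lmal := by
    simp only [ColPerm.mem_Lmal_iff, h.records_iff]
  have hLmap (a : Fin n) (t : ZMod r) : (a, -t) ∈ (φ π).Lmap ↔ (a, t) ∈ π.Lmap := by
    simp only [ColPerm.mem_Lmap_iff, h.records_iff]
  simp only [Set.mem_ofPred_eq, ColPerm.colorPart, ColPerm.length_eq_lengthSum, h.sor_eq,
    h.mem_restricted_iff hf, h.cyc_iff, h.lmic_iff, hLmal, hLmap]
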